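/- Let $\Gamma$ be a finite set, let $\Sigma$ and $S'$ be (usually finite) sets, let $S=\Sigma^{\Gamma}$ be the set of black boxes $x:\Gamma\to\Sigma$, and let $F:S\to S'$ be a partial function. The values in $\Sigma$ are encoded injectively in an abelian group $(G,\oplus)$ (for instance bit strings with bitwise XOR), and we write $x(i)$ also for the encoded value. A nonadaptive quantum algorithm $\mathcal A$ with $T$ queries is given by a pair $(U,V)$ of unitary operators on the Hilbert space with orthonormal basis $|i_1,\dots,i_T\rangle|\varphi_1,\dots,\varphi_T\rangle|\psi\rangle$, where $i_j\in\Gamma$, $\varphi_j\in G$, and $\psi$ ranges over the basis labels of an arbitrary work register. For $x\in S$ let $$O_x^T|i_1,\dots,i_T\rangle|\varphi_1,\dots,\varphi_T\rangle|\psi\rangle=|i_1,\dots,i_T\rangle|\varphi_1\oplus x(i_1),\dots,\varphi_T\oplus x(i_T)\rangle|\psi\rangle .$$ On input $x$ the algorithm computes the state $VO_x^TU|0\rangle$ from a fixed basis state $|0\rangle$ and measures it in the computational basis; the result determines the output in $S'$. The algorithm computes $F$ with error at most $\varepsilon$ if on every input $x$ in the domain of $F$ it outputs $F(x)$ with probability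 at least $1-\varepsilon$. The nonadaptive quantum query complexity $Q^{na}_{2,\varepsilon}(F)$ is the smallest $T$ for which some nonadaptive quantum algorithm with $T$ queries computes $F$ with error at most $\varepsilon$ ($\infty$ if there is none). A valid weight function for $F$ is a function $w:S^2\to\mathbb R_{\ge 0}$ with $w(x,y)=w(y,x)$ for all $x,y$, and with $w(x,y)=0$ whenever $x$ or $y$ is outside the domain of $F$ or $F(x)=F(y)$; if $\Sigma$ is infinite, we also require $\sum_y w(x,y)<\infty$ for all $x$. Put $$wt(x)=\sum_{y} w(x,y),\qquad v(x,i)=\sum_{y:\,x(i)\ne y(i)} w(x,y)\qquad (x\in S,\ i\in\Gamma).$$ Let $$L_Q^{na}(F)=\max_{w}\ \max_{s\in S'}\ \min_{\substack{x,i\\ F(x)=s}}\ \frac{wt(x)}{v(x,i)},$$ where $w$ ranges over the valid weight functions, the minimum is taken over the pairs $(x,i)$ with $F(x)=s$ for which $v(x,i)>0$, and the maximum over those $(w,s)$ for which there is at least one such pair. (Maximum and minimum are read as supremum and infimum; $L_Q^{na}(F)=0$ if there is no such $(w,s)$.) **Theorem.** For every $\varepsilon\in[0,\tfrac12)$, $$Q^{na}_{2,\varepsilon}(F)\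 \ge\ C_\varepsilon^2\,L_Q^{na}(F),\qquad\text{where } C_\varepsilon=\frac{1-2\sqrt{\varepsilon(1-\varepsilon)}}{2}.$$ -/

import Mathlib

open scoped ENNReal NNReal

noncomputable section

namespace NonadaptiveQuery

/-- The Hilbert space `ℓ²(B)` with computational basis indexed by `B`; it is `ℂ^B` when `B` is
finite. -/
abbrev StateSpace (B : Type*) : Type _ := lp (fun _ : B => ℂ) 2

/-- The computational basis vector `|b⟩`. -/
def ket {B : Type*} (b : B) : StateSpace B :=
  open scoped Classical in lp.single 2 b (1 : ℂ)

theorem memlp_comp_equiv {B : Type*} (e : B ≃ B) (ψ : StateSpace B) :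
    Memℓp (fun b => ψ (e b)) 2 := by
  have h := lp.memℓp ψ
  rw [memℓp_gen_iff (by norm_num)] at h ⊢
  exact (e.summable_iff (f := fun b => ‖ψ b‖ ^ (2 : ℝ≥0∞).toReal)).2 h

/-- The unitary operator permuting the computational basis: `|b⟩ ↦ |e b⟩`. -/
def permUnitary {B : Type*} (e : B ≃ B) : StateSpace B ≃ₗᵢ[ℂ] StateSpace B where
  toFun ψ := ⟨fun b => ψ (e.symm b), memlp_comp_equiv e.symm ψ⟩
  invFun ψ := ⟨fun b => ψ (e b), memlp_comp_equiv e ψ⟩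
  map_add' ψ χ := rfl
  map_smul' c ψ := rfl
  left_inv ψ := by ext b; simp
  right_inv ψ := by ext b; simp
  norm_map' ψ := by
    rw [lp.norm_eq_tsum_rpow (by norm_num), lp.norm_eq_tsum_rpow (by norm_num)]
    congr 1
    exact e.symm.tsum_eq (fun b => ‖ψ b‖ ^ (2 : ℝ≥0∞).toReal)

theorem permUnitary_ket {B : Type*} (e : B ≃ B) (b : B) : permUnitary e (ket b) = ket (e b) := by
  classical
  ext c
  change (ket b : StateSpace B) (e.symm c) = (ket (e b) : StateSpace B) c
  simp only [ket, lp.single_apply, Pi.single_apply, Equiv.symm_apply_eq]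

/-- Basis labels `|i₁, …, i_T⟩ |φ₁, …, φ_T⟩ |ψ⟩`: `T` query indices in `Γ`, `T` answer registers
with values in the group `G`, and a work register with values in `W`. -/
abbrev Label (Γ G W : Type*) (T : ℕ) : Type _ := (Fin T → Γ) × (Fin T → G) × W

/-- The permutation of the basis labels that adds `x (i_j)` (encoded in the group `G` of the
answer register) to `φ_j` for all `j` simultaneously. -/
def oraclePerm {Γ A G : Type*} [AddCommGroup G] (W : Type*) (T : ℕ) (enc : A ↪ G) (x : Γ → A) :
    Label Γ G W T ≃ Label Γ G W T where
  toFun b := (b.1, fun j => b.2.1 j + enc (x (b.1 j)), b.2.2)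
  invFun b := (b.1, fun j => b.2.1 j - enc (x (b.1 j)), b.2.2)
  left_inv b := by simp
  right_inv b := by simp

/-- The parallel call to the black box, `O_x^T`. -/
def oracle {Γ A G : Type*} [AddCommGroup G] (W : Type*) (T : ℕ) (enc : A ↪ G) (x : Γ → A) :
    StateSpace (Label Γ G W T) ≃ₗᵢ[ℂ] StateSpace (Label Γ G W T) :=
  permUnitary (oraclePerm W T enc x)

/-- A nonadaptive quantum algorithm with `T` queries: two unitaries `U`, `V`, an initial basis
state, and a final measurement in the computational basis whose result is read as an element of the
output set `R`. (Measuring only some of the registers is the case in which `out` depends only on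
them.) The work register is unrestricted; any finite number of qubits is allowed. -/
structure NonadaptiveAlgorithm (Γ G R : Type*) (T : ℕ) where
  W : Type
  start : Label Γ G W T
  U : StateSpace (Label Γ G W T) ≃ₗᵢ[ℂ] StateSpace (Label Γ G W T)
  V : StateSpace (Label Γ G W T) ≃ₗᵢ[ℂ] StateSpace (Label Γ G W T)
  out : Label Γ G W T → R

namespace NonadaptiveAlgorithm

variable {Γ A G R : Type*} [AddCommGroup G] {T : ℕ}

/-- The final state `V O_x^T U |0⟩`. -/
def finalState (𝒜 : NonadaptiveAlgorithm Γ G R T) (enc : A ↪ G) (x : Γ → A) :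
    StateSpace (Label Γ G 𝒜.W T) :=
  𝒜.V (oracle 𝒜.W T enc x (𝒜.U (ket 𝒜.start)))

/-- The probability that the outcome on input `x` is `s`. -/
def outputProb (𝒜 : NonadaptiveAlgorithm Γ G R T) (enc : A ↪ G) (x : Γ → A) (s : R) : ℝ :=
  ∑' b : {b : Label Γ G 𝒜.W T // 𝒜.out b = s}, ‖𝒜.finalState enc x b.1‖ ^ 2

/-- `𝒜` computes the partial function `F` with probability of error at most `ε`. -/
def Computes (𝒜 : NonadaptiveAlgorithm Γ G R T) (enc : A ↪ G) (F : (Γ → A) →. R) (ε : ℝ) : Prop :=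
  ∀ x : Γ → A, ∀ s : R, s ∈ F x → 1 - ε ≤ 𝒜.outputProb enc x s

end NonadaptiveAlgorithm

/-- The nonadaptive quantum query complexity `Q^{na}_{2,ε}(F)`: the least `T` such that some
nonadaptive algorithm with `T` queries computes `F` with error at most `ε` (and `⊤` if there is no
such algorithm). -/
def queryComplexity {Γ A G R : Type*} [AddCommGroup G] (enc : A ↪ G) (F : (Γ → A) →. R) (ε : ℝ) :
    ℕ∞ :=
  ⨅ (T : ℕ) (_ : ∃ 𝒜 : NonadaptiveAlgorithm Γ G R T, 𝒜.Computes enc F ε), (T : ℕ∞)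

section Weights

variable {Γ A R : Type*}

/-- `wt(x) = ∑_y w(x,y)`. -/
def wt (w : (Γ → A) → (Γ → A) → ℝ≥0) (x : Γ → A) : ℝ≥0∞ :=
  ∑' y : Γ → A, (w x y : ℝ≥0∞)

/-- `v(x,i) = ∑_{y : x(i) ≠ y(i)} w(x,y)`. -/
def v (w : (Γ → A) → (Γ → A) → ℝ≥0) (x : Γ → A) (i : Γ) : ℝ≥0∞ :=
  ∑' y : {y : Γ → A // x i ≠ y i}, (w x y.1 : ℝ≥0∞)

/-- Valid weight functions for the partial function `F`: symmetric, supported on pairs of inputs in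
the domain of `F` with different values, and with finite sums `wt(x)` (automatic if there are
finitely many black boxes). -/
structure IsValidWeight (F : (Γ → A) →. R) (w : (Γ → A) → (Γ → A) → ℝ≥0) : Prop where
  symm : ∀ x y, w x y = w y x
  dom : ∀ x y, w x y ≠ 0 → x ∈ F.Dom ∧ y ∈ F.Dom
  eq_zero : ∀ x y, F x = F y → w x y = 0
  finite : ∀ x, wt w x ≠ ⊤

/-- `L_Q^{na}(F) = max_w max_s min_{x,i : F(x) = s} wt(x) / v(x,i)`. The minimum is over the pairs
`(x,i)` for which the quotient is defined, i.e. `v(x,i) ≠ 0`, and the maximum is over those `(w,s)`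
for which there is such a pair, i.e. for which `w` does not vanish identically on `F⁻¹(s)`. -/
def LQna (F : (Γ → A) →. R) : ℝ≥0∞ :=
  ⨆ (w : (Γ → A) → (Γ → A) → ℝ≥0) (_ : IsValidWeight F w)
    (s : R) (_ : ∃ x i, s ∈ F x ∧ v w x i ≠ 0),
    ⨅ (x : Γ → A) (i : Γ) (_ : s ∈ F x) (_ : v w x i ≠ 0), wt w x / v w x i

end Weights

/-- `C_ε = (1 - 2 √(ε (1 - ε))) / 2`. -/
def Cconst (ε : ℝ) : ℝ := (1 - 2 * √(ε * (1 - ε))) / 2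

end NonadaptiveQuery

end

/-! The state before the only oracle call does not depend on the input, so a single `x` suffices.
Inputs with different values lead to final states at squared distance at least 4C_ε
(`four_mul_Cconst_le_norm_sub_sq`), while the oracle can separate them only on labels that query a
place of difference (`oracle_sub_oracle_norm_sq_le`). Hence each relevant `y` has query mass at
least C_ε where it differs from `x`. Averaging over `y` with weights `w x y` turns this mass into
the values `v w x i`, each at most wt(x)/m with m the minimum. As the total mass is 1 and each label
makes `T` queries, C_ε·m ≤ T, and C_ε² ≤ C_ε. -/

namespace NonadaptiveQuery

/-! ### Distance between distinguishable states. -/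

section StateSpace

variable {B : Type*}

theorem summable_norm_sq (ψ : StateSpace B) : Summable fun b => ‖ψ b‖ ^ 2 := by
  have h := lp.memℓp ψ
  rw [memℓp_gen_iff (by norm_num)] at h
  simpa using h

theorem norm_sq_eq_tsum (ψ : StateSpace B) : ‖ψ‖ ^ 2 = ∑' b, ‖ψ b‖ ^ 2 := by
  have h := lp.norm_rpow_eq_tsum (p := 2) (by norm_num) ψ
  simpa using h

theorem norm_ket (b : B) : ‖ket b‖ = 1 := by
  classical
  simp [ket, lp.norm_single]

/-- The vector that agrees with `ψ` on `s` and with `χ` off `s`. -/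
noncomputable def splice (s : Set B) (ψ χ : StateSpace B) : StateSpace B :=
  open scoped Classical in
  ⟨fun b => if b ∈ s then ψ b else χ b, by
    change Memℓp _ 2
    rw [memℓp_gen_iff (by norm_num)]
    refine Summable.of_nonneg_of_le (fun b => by positivity) (fun b => ?_)
      ((summable_norm_sq ψ).add (summable_norm_sq χ))
    by_cases h : b ∈ s <;> simp [h]⟩

open scoped Classical in
theorem splice_apply (s : Set B) (ψ χ : StateSpace B) (b : B) :
    splice s ψ χ b = if b ∈ s then ψ b else χ b := rfl

theorem norm_sq_splice_add (s : Set B) (ψ χ : StateSpace B) :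
    ‖splice s ψ χ‖ ^ 2 + ‖splice s χ ψ‖ ^ 2 = ‖ψ‖ ^ 2 + ‖χ‖ ^ 2 := by
  simp only [norm_sq_eq_tsum]
  rw [← (summable_norm_sq _).tsum_add (summable_norm_sq _),
    ← (summable_norm_sq _).tsum_add (summable_norm_sq _)]
  refine tsum_congr fun b => ?_
  by_cases h : b ∈ s <;> simp [splice_apply, h, add_comm]

theorem norm_splice_sub (s : Set B) (ψ χ : StateSpace B) :
    ‖splice s ψ χ - splice s χ ψ‖ = ‖ψ - χ‖ := by
  rw [← sq_eq_sq₀ (norm_nonneg _) (norm_nonneg _), norm_sq_eq_tsum, norm_sq_eq_tsum]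
  refine tsum_congr fun b => ?_
  by_cases h : b ∈ s <;> simp [splice_apply, h, norm_sub_rev]

/-- Exchanging coordinates off `s` gathers both success probabilities in one vector, because `t`
lies off `s`. -/
theorem tsum_subtype_add_le_norm_sq_splice (s t : Set B) (hst : Disjoint s t)
    (ψ χ : StateSpace B) :
    ∑' b : s, ‖ψ b‖ ^ 2 + ∑' b : t, ‖χ b‖ ^ 2 ≤ ‖splice s ψ χ‖ ^ 2 := by
  rw [norm_sq_eq_tsum, tsum_subtype s fun b => ‖ψ b‖ ^ 2, tsum_subtype t fun b => ‖χ b‖ ^ 2,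
    ← ((summable_norm_sq ψ).indicator s).tsum_add ((summable_norm_sq χ).indicator t)]
  refine Summable.tsum_le_tsum (fun b => ?_)
    (((summable_norm_sq ψ).indicator s).add ((summable_norm_sq χ).indicator t))
    (summable_norm_sq _)
  by_cases h : b ∈ s
  · have h' : b ∉ t := Set.disjoint_left.1 hst h
    simp [splice_apply, h, h']
  · by_cases h' : b ∈ t <;> simp [splice_apply, h, h']

/-- Two states that are distinguished by a measurement with error at most `ε` are far apart. -/
theorem four_mul_Cconst_le_norm_sub_sq {ε : ℝ} (hε' : ε < 1 / 2) {s t : Set B}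
    (hst : Disjoint s t) {ψ χ : StateSpace B} (hψ : ‖ψ‖ = 1) (hχ : ‖χ‖ = 1)
    (hs : 1 - ε ≤ ∑' b : s, ‖ψ b‖ ^ 2) (ht : 1 - ε ≤ ∑' b : t, ‖χ b‖ ^ 2) :
    4 * Cconst ε ≤ ‖ψ - χ‖ ^ 2 := by
  have h₁ := norm_sq_splice_add s ψ χ
  have h₂ := tsum_subtype_add_le_norm_sq_splice s t hst ψ χ
  have h₃ := abs_norm_sub_norm_le (splice s ψ χ) (splice s χ ψ)
  rw [norm_splice_sub] at h₃
  rw [hψ, hχ] at h₁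
  set p := ‖splice s ψ χ‖
  set q := ‖splice s χ ψ‖
  have h₄ : (p - q) ^ 2 ≤ ‖ψ - χ‖ ^ 2 := by
    rw [← sq_abs (p - q)]
    gcongr
  -- With u = q² ≤ 2ε < 1, p²q² = u(2 - u), which increases for u ≤ 1. Then (p - q)² = 2 - 2pq gives
  -- the claim.
  have h₅ : p * q / 2 ≤ √(ε * (1 - ε)) := by
    apply Real.le_sqrt_of_sq_le
    have hq : q ^ 2 ≤ 2 * ε := by linarith
    have hp : p ^ 2 = 2 - q ^ 2 := by linarith
    rw [div_pow, mul_pow, hp]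
    nlinarith
  unfold Cconst
  nlinarith

end StateSpace

/-! ### Effect of changing the input of the oracle. -/

section Oracle

variable {Γ A G : Type*} [AddCommGroup G] {W : Type*} {T : ℕ}

theorem oracle_sub_oracle_norm_sq_le (enc : A ↪ G) (x y : Γ → A)
    (φ : StateSpace (Label Γ G W T)) :
    ‖oracle W T enc x φ - oracle W T enc y φ‖ ^ 2 ≤
      4 * ∑' b, {b : Label Γ G W T | ∃ j, x (b.1 j) ≠ y (b.1 j)}.indicator
        (fun b => ‖φ b‖ ^ 2) b := by
  set D : Set (Label Γ G W T) := {b | ∃ j, x (b.1 j) ≠ y (b.1 j)} with hD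
  set g : Label Γ G W T → ℝ := D.indicator fun b => ‖φ b‖ ^ 2 with hg
  have hsum : Summable g := (summable_norm_sq φ).indicator D
  have hperm (z : Γ → A) : Summable fun b => g ((oraclePerm W T enc z).symm b) :=
    (oraclePerm W T enc z).symm.summable_iff.2 hsum
  have htsum (z : Γ → A) : ∑' b, g ((oraclePerm W T enc z).symm b) = ∑' b, g b :=
    (oraclePerm W T enc z).symm.tsum_eq g
  -- The oracle leaves the index registers fixed, and `D` depends on them alone.
  have hmem (z : Γ → A) (b : Label Γ G W T) : (oraclePerm W T enc z).symm b ∈ D ↔ b ∈ D :=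
    Iff.rfl
  calc
    _ = ∑' b, ‖φ ((oraclePerm W T enc x).symm b) - φ ((oraclePerm W T enc y).symm b)‖ ^ 2 :=
      norm_sq_eq_tsum _
    _ ≤ ∑' b, (2 * g ((oraclePerm W T enc x).symm b) +
          2 * g ((oraclePerm W T enc y).symm b)) := by
      refine Summable.tsum_le_tsum (fun b => ?_) (summable_norm_sq
        (oracle W T enc x φ - oracle W T enc y φ)) (((hperm x).mul_left 2).add
          ((hperm y).mul_left 2))
      by_cases h : b ∈ D
      · simp only [hg, Set.indicator_of_mem ((hmem x b).2 h),
          Set.indicator_of_mem ((hmem y b).2 h)]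
        have h₁ := norm_sub_le (φ ((oraclePerm W T enc x).symm b))
          (φ ((oraclePerm W T enc y).symm b))
        have h₂ := add_sq_le (a := ‖φ ((oraclePerm W T enc x).symm b)‖)
          (b := ‖φ ((oraclePerm W T enc y).symm b)‖)
        have h₃ := pow_le_pow_left₀ (norm_nonneg _) h₁ 2
        linarith
      · have hb : (oraclePerm W T enc x).symm b = (oraclePerm W T enc y).symm b := by
          have h' : ∀ j, x (b.1 j) = y (b.1 j) := by simpa [hD] using h
          simp [oraclePerm, h']
        have hnn : 0 ≤ g ((oraclePerm W T enc y).symm b) :=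
          Set.indicator_nonneg (fun b _ => by positivity) _
        rw [hb, sub_self, norm_zero]
        linarith
    _ = 4 * ∑' b, g b := by
      rw [((hperm x).mul_left 2).tsum_add ((hperm y).mul_left 2), tsum_mul_left, tsum_mul_left,
        htsum, htsum]
      ring

end Oracle

/-! ### Query mass and the weighted count. -/

section Bound

variable {Γ A G R : Type*} {T : ℕ}

namespace NonadaptiveAlgorithm

/-- The probability of the basis label `b` in the state `U|0⟩` queried by the algorithm. -/
noncomputable def queryMass (𝒜 : NonadaptiveAlgorithm Γ G R T) (b : Label Γ G 𝒜.W T) : ℝ≥0∞ :=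
  ENNReal.ofReal (‖𝒜.U (ket 𝒜.start) b‖ ^ 2)

theorem tsum_queryMass (𝒜 : NonadaptiveAlgorithm Γ G R T) : ∑' b, 𝒜.queryMass b = 1 := by
  unfold queryMass
  rw [← ENNReal.ofReal_tsum_of_nonneg (fun b => by positivity) (summable_norm_sq _),
    ← norm_sq_eq_tsum]
  simp [norm_ket]

variable [AddCommGroup G]

theorem norm_finalState (𝒜 : NonadaptiveAlgorithm Γ G R T) (enc : A ↪ G) (x : Γ → A) :
    ‖𝒜.finalState enc x‖ = 1 := by
  simp [finalState, norm_ket]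

open scoped Classical in
/-- The total query mass on the places where `x` and `y` differ is at least `C_ε`. -/
theorem Computes.ofReal_Cconst_le {𝒜 : NonadaptiveAlgorithm Γ G R T} {enc : A ↪ G}
    {F : (Γ → A) →. R} {ε : ℝ} (h : 𝒜.Computes enc F ε) (hε' : ε < 1 / 2) {x y : Γ → A}
    (hx : x ∈ F.Dom) (hy : y ∈ F.Dom) (hxy : F x ≠ F y) :
    ENNReal.ofReal (Cconst ε) ≤
      ∑' b, ∑ j, if x (b.1 j) ≠ y (b.1 j) then 𝒜.queryMass b else 0 := by
  obtain ⟨s, hs⟩ := Part.dom_iff_mem.1 hx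
  obtain ⟨t, ht⟩ := Part.dom_iff_mem.1 hy
  have hst : s ≠ t := by
    rintro rfl
    exact hxy ((Part.eq_some_iff.2 hs).trans (Part.eq_some_iff.2 ht).symm)
  have hdisj : Disjoint {b | 𝒜.out b = s} {b | 𝒜.out b = t} :=
    Set.disjoint_left.2 fun b hb hb' => hst (hb.symm.trans hb')
  have h₁ := four_mul_Cconst_le_norm_sub_sq hε' hdisj (𝒜.norm_finalState enc x)
    (𝒜.norm_finalState enc y) (h x s hs) (h y t ht)
  have h₂ := oracle_sub_oracle_norm_sq_le enc x y (𝒜.U (ket 𝒜.start))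
  rw [finalState, finalState, ← map_sub, LinearIsometryEquiv.norm_map] at h₁
  refine (ENNReal.ofReal_le_ofReal (by linarith)).trans ((ENNReal.ofReal_tsum_of_nonneg
    (fun b => Set.indicator_nonneg (fun b _ => by positivity) _)
    ((summable_norm_sq _).indicator _)).trans_le (ENNReal.tsum_le_tsum fun b => ?_))
  by_cases hb : b ∈ {b : Label Γ G 𝒜.W T | ∃ j, x (b.1 j) ≠ y (b.1 j)}
  · refine (congrArg ENNReal.ofReal (Set.indicator_of_mem hb _)).trans_le ?_
    obtain ⟨j, hj⟩ := hb
    refine le_trans ?_ (Finset.single_le_sum (fun _ _ => zero_le) (Finset.mem_univ j))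
    rw [if_pos hj]
    rfl
  · refine (congrArg ENNReal.ofReal (Set.indicator_of_notMem hb _)).trans_le ?_
    simp

end NonadaptiveAlgorithm

open scoped Classical in
theorem v_eq_tsum_ite (w : (Γ → A) → (Γ → A) → ℝ≥0) (x : Γ → A) (i : Γ) :
    v w x i = ∑' y, if x i ≠ y i then (w x y : ℝ≥0∞) else 0 := by
  refine (tsum_subtype {y : Γ → A | x i ≠ y i} fun y => (w x y : ℝ≥0∞)).trans ?_
  exact tsum_congr fun y => by simp [Set.indicator_apply]

theorem v_le_wt (w : (Γ → A) → (Γ → A) → ℝ≥0) (x : Γ → A) (i : Γ) : v w x i ≤ wt w x :=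
  ENNReal.tsum_comp_le_tsum_of_injective Subtype.val_injective _

open scoped Classical in
theorem NonadaptiveAlgorithm.Computes.ofReal_Cconst_mul_wt_le [AddCommGroup G]
    {𝒜 : NonadaptiveAlgorithm Γ G R T} {enc : A ↪ G} {F : (Γ → A) →. R} {ε : ℝ}
    (h : 𝒜.Computes enc F ε) (hε' : ε < 1 / 2) {w : (Γ → A) → (Γ → A) → ℝ≥0}
    (hw : IsValidWeight F w) (x : Γ → A) :
    ENNReal.ofReal (Cconst ε) * wt w x ≤ ∑' b, ∑ j, 𝒜.queryMass b * v w x (b.1 j) := by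
  calc
    _ = ∑' y, ENNReal.ofReal (Cconst ε) * w x y := ENNReal.tsum_mul_left.symm
    _ ≤ ∑' y, (∑' b, ∑ j, if x (b.1 j) ≠ y (b.1 j) then 𝒜.queryMass b else 0) * w x y := by
      refine ENNReal.tsum_le_tsum fun y => ?_
      by_cases h₀ : w x y = 0
      · simp [h₀]
      · gcongr
        exact h.ofReal_Cconst_le hε' (hw.dom x y h₀).1 (hw.dom x y h₀).2
          fun hF => h₀ (hw.eq_zero x y hF)
    _ = ∑' b, ∑ j, 𝒜.queryMass b * v w x (b.1 j) := by
      simp_rw [← ENNReal.tsum_mul_right, Finset.sum_mul]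
      rw [ENNReal.tsum_comm]
      refine tsum_congr fun b => ?_
      rw [Summable.tsum_finsetSum fun _ _ => ENNReal.summable]
      refine Finset.sum_congr rfl fun j _ => ?_
      rw [v_eq_tsum_ite, ← ENNReal.tsum_mul_left]
      exact tsum_congr fun y => by split_ifs <;> simp

theorem NonadaptiveAlgorithm.Computes.ofReal_Cconst_mul_LQna_le [AddCommGroup G]
    {𝒜 : NonadaptiveAlgorithm Γ G R T} {enc : A ↪ G} {F : (Γ → A) →. R} {ε : ℝ}
    (h : 𝒜.Computes enc F ε) (hε' : ε < 1 / 2) :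
    ENNReal.ofReal (Cconst ε) * LQna F ≤ T := by
  simp only [LQna, ENNReal.mul_iSup]
  refine iSup_le fun w => iSup_le fun hw => iSup_le fun s => iSup_le ?_
  rintro ⟨x, i, hs, hv⟩
  set m := ⨅ (x : Γ → A) (i : Γ) (_ : s ∈ F x) (_ : v w x i ≠ 0), wt w x / v w x i
  -- In product form the bound also covers the indices with `v w x k = 0`, which the minimum omits.
  have hm (k : Γ) : v w x k * m ≤ wt w x := by
    by_cases hk : v w x k = 0
    · simp [hk]
    · rw [mul_comm]
      exact ENNReal.mul_le_of_le_div
        ((iInf_le _ x).trans ((iInf_le _ k).trans ((iInf_le _ hs).trans (iInf_le _ hk))))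
  have hwt : wt w x ≠ 0 := fun h₀ => hv (le_antisymm (h₀ ▸ v_le_wt w x i) zero_le)
  refine (ENNReal.mul_le_mul_iff_left hwt (hw.finite x)).1 ?_
  calc
    _ = ENNReal.ofReal (Cconst ε) * wt w x * m := mul_right_comm _ _ _
    _ ≤ (∑' b, ∑ j, 𝒜.queryMass b * v w x (b.1 j)) * m := by
      gcongr
      exact h.ofReal_Cconst_mul_wt_le hε' hw x
    _ = ∑' b, ∑ j, 𝒜.queryMass b * (v w x (b.1 j) * m) := by
      simp_rw [← ENNReal.tsum_mul_right, Finset.sum_mul, mul_assoc]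
    _ ≤ ∑' b, ∑ _j : Fin T, 𝒜.queryMass b * wt w x := by
      gcongr
      exact hm _
    _ = T * wt w x := by
      simp only [Finset.sum_const, Finset.card_univ, Fintype.card_fin, nsmul_eq_mul]
      rw [ENNReal.tsum_mul_left, ENNReal.tsum_mul_right, 𝒜.tsum_queryMass, one_mul]

theorem Cconst_sq_le (ε : ℝ) : Cconst ε ^ 2 ≤ Cconst ε := by
  have h₀ : 0 ≤ √(ε * (1 - ε)) := Real.sqrt_nonneg _
  have h₁ : √(ε * (1 - ε)) ≤ 1 / 2 := Real.sqrt_le_iff.2 ⟨by norm_num, by nlinarith [sq_nonneg (ε - 1 / 2)]⟩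
  unfold Cconst
  nlinarith

end Bound

end NonadaptiveQuery

open NonadaptiveQuery in
theorem mainTheorem1 {Γ A G R : Type*} [Finite Γ] [AddCommGroup G] (enc : A ↪ G)
    (F : (Γ → A) →. R) (ε : ℝ) (hε : 0 ≤ ε) (hε' : ε < 1 / 2) :
    ENNReal.ofReal (NonadaptiveQuery.Cconst ε ^ 2) * NonadaptiveQuery.LQna F ≤
      (NonadaptiveQuery.queryComplexity enc F ε : ENNReal) := by
  simp only [queryComplexity, ENat.toENNReal_iInf]
  refine le_iInf fun T => le_iInf ?_
  rintro ⟨𝒜, h⟩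
  calc
    _ ≤ ENNReal.ofReal (Cconst ε) * LQna F := by
      gcongr
      exact Cconst_sq_le ε
    _ ≤ T := h.ofReal_Cconst_mul_LQna_le hε'
    _ = ((T : ℕ∞) : ℝ≥0∞) := (ENat.toENNReal_coe T).symm
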